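/- Let $n\ge 2$ and equip $\mathbb{R}^n$ with the Euclidean inner product $\langle\cdot,\cdot\rangle$ and norm $\|\cdot\|$. For $r\in\mathbb{R}$, a set $A\subseteq\mathbb{R}^n$ is called $r$-convex if for all $x,y\in A$ the intersection of all closed balls $\bar B(c,r)=\{z : \|z-c\|\le r\}$ that contain both $x$ and $y$ is contained in $A$ (the intersection is $\mathbb{R}^n$ if there is no such ball). A unit normal to $A$ at a boundary point $x\in\partial A$ is a vector $v$ with $\|v\|=1$ and $\langle v,y-x\rangle\le 0$ for all $y\in A$. A map is of class $C^{1,1}$ on an open set if it is continuously differentiable with Lipschitz continuous derivative there; a $C^{1,1}$-diffeomorphism is a bijection between open sets that is of class $C^{1,1}$ together with its inverse. Let $\Phi\colon U\to V$ be a $C^{1,1}$-diffeomorphism between open sets $U,V\subseteq\mathbb{R}^n$, let $s>0$, and let $\Omega\subseteq U$ be $s$-convex and closed in $\mathbb{R}^n$, $\Omega\neq\mathbb{R}^n$. Let $L_1,L_2\in\mathbb{R}$, and assume that for each $x\in\partial\Omega$ there exists a unit normal $v$ to $\Omega$ at $x$ such that for all $\xi\in\mathbb{R}^n$ with $\xi\perp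 v$, $$L_1\|\xi\|^2\ \ge\ \limsup_{t\to0,\,t>0}\frac{\langle v,\Phi'(x)^{-1}(\Phi'(x+t\xi)\xi-\Phi'(x)\xi)\rangle}{t},$$ $$L_2\|\xi\|^2\ \ge\ \|\Phi'(x)\xi\|^2\cdot\|\Phi'(x)^{-1}\|,$$ where $\|\Phi'(x)^{-1}\|$ is the operator norm. If $sL_1<1$, then $\Phi(\Omega)$ is $r$-convex for $$r=\frac{sL_2}{1-sL_1},$$ and $r>0$ whenever $\Omega\ne\emptyset$. -/

import Mathlib

open Filter Topology
open scoped NNReal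

/-- `Ω` is `r`-convex: for all `x, y ∈ Ω`, the intersection of all closed balls of radius `r` that
contain both `x` and `y` is contained in `Ω`. If there is no such ball, the intersection is the
whole space. -/
def IsRConvex {n : ℕ} (r : ℝ) (Ω : Set (EuclideanSpace ℝ (Fin n))) : Prop :=
  ∀ x ∈ Ω, ∀ y ∈ Ω,
    (⋂ c ∈ {c : EuclideanSpace ℝ (Fin n) |
        x ∈ Metric.closedBall c r ∧ y ∈ Metric.closedBall c r}, Metric.closedBall c r) ⊆ Ω

/-- `v` is a unit normal to `Ω` at the boundary point `x`. -/
def IsUnitNormal {n : ℕ} (Ω : Set (EuclideanSpace ℝ (Fin n)))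
    (x v : EuclideanSpace ℝ (Fin n)) : Prop :=
  x ∈ frontier Ω ∧ ‖v‖ = 1 ∧ ∀ y ∈ Ω, inner ℝ v (y - x) ≤ 0

/-- `f` is of class `C^{1,1}` on the (open) set `U`: it is continuously differentiable there and
its derivative is Lipschitz continuous on `U`. -/
def IsC11On {n : ℕ} (f : EuclideanSpace ℝ (Fin n) → EuclideanSpace ℝ (Fin n))
    (U : Set (EuclideanSpace ℝ (Fin n))) : Prop :=
  ContDiffOn ℝ 1 f U ∧ ∃ K : ℝ≥0, LipschitzOnWith K (fderiv ℝ f) U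

/-- `Φ` restricts to a `C^{1,1}`-diffeomorphism of the open set `U` onto the open set `V`:
a bijection which, together with its inverse, is of class `C^{1,1}`. -/
def IsC11Diffeo {n : ℕ} (Φ : EuclideanSpace ℝ (Fin n) → EuclideanSpace ℝ (Fin n))
    (U V : Set (EuclideanSpace ℝ (Fin n))) : Prop :=
  IsOpen U ∧ IsOpen V ∧ Set.BijOn Φ U V ∧ IsC11On Φ U ∧
    ∃ Ψ : EuclideanSpace ℝ (Fin n) → EuclideanSpace ℝ (Fin n),
      Set.InvOn Ψ Φ U V ∧ IsC11On Ψ V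

/-! A closed `s`-convex set other than the whole space lies, at each boundary point `x` with unit
normal `v`, in the ball of radius `s` touching there: `‖y - x‖ ^ 2 + 2 * s * ⟪y - x, v⟫ ≤ 0`.
Conversely, touching balls of radius `r` at all points outside a nonempty open subset give
`r`-convexity (`isRConvex_of_supported`). So it suffices to transport touching balls through `Φ`.

Locally this is a second-order expansion (`eventually_image_supported`). Write `y = x + η - a • v`
with `η ⊥ v`, so that `‖η‖ ^ 2 ≤ 2 * s * a`. With `M = Φ'(x)⁻¹`, up to errors `o(a)`, the normal
term `⟪v, M (Φ y - Φ x)⟫` is at most `L / 2 * ‖η‖ ^ 2 - a` for any `L > L₁`, and `‖M‖ * ‖Φ y - Φ x‖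
^ 2` is at most `L₂ * ‖η‖ ^ 2`. A ball of radius `R` then supports the image near `Φ x` as soon as
`s * L₂ < R * (1 - s * L₁)`. The strict inequality absorbs the errors, so only radii `R > r` are
obtained.

The passage from local to global is a Blaschke-type argument by sweeping (`forall_mem_of_sweep`). A
circle of radius larger than `r` that runs in the image cannot touch its boundary. Moving segments,
arcs and circles continuously shows in turn that the image of the interior is convex, contains short
arcs of radius `R` between its points, and has diameter at most `2 * R`. Arcs ending at a boundary
point stay in the supporting half-space there, which forces the global ball of radius `R`; finally
`R` decreases to `r`. -/

section Geometry

/-! ### Circular arcs, sweeping, and global support from local support -/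

variable {E : Type*} [NormedAddCommGroup E] [InnerProductSpace ℝ E]

theorem mem_closedBall_sub_smul_iff {p w z : E} {r : ℝ} (hr : 0 ≤ r) (hw : ‖w‖ = 1) :
    z ∈ Metric.closedBall (p - r • w) r ↔ ‖z - p‖ ^ 2 + 2 * r * inner ℝ (z - p) w ≤ 0 := by
  rw [mem_closedBall_iff_norm, ← sq_le_sq₀ (norm_nonneg _) hr,
    show z - (p - r • w) = (z - p) + r • w by abel, norm_add_sq_real, inner_smul_right, norm_smul,
    hw, Real.norm_eq_abs, mul_one, sq_abs]
  constructor <;> intro h <;> linarith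

/-- The point at angle `θ` of the circular arc of radius `R` that starts at `x` for `θ = -φ` and
ends at `x + (2 * R * sin φ) • u` for `θ = φ`. -/
noncomputable def circularArc (x u e : E) (R φ θ : ℝ) : E :=
  x + (R * (Real.sin θ + Real.sin φ)) • u + (R * (Real.cos θ - Real.cos φ)) • e

theorem circularArc_eq (x u e : E) (R φ θ : ℝ) :
    circularArc x u e R φ θ = (x + (R * Real.sin φ) • u - (R * Real.cos φ) • e) +
      (R * Real.cos θ) • e + (R * Real.sin θ) • u := by
  simp only [circularArc, mul_add, mul_sub, add_smul, sub_smul]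
  abel

/-- A circle cannot run inside a set near a point at which the set is locally contained in a
touching ball of smaller radius. -/
theorem not_circle_eventually_mem {A : Set E} {o u e w : E} {R ρ θ₀ : ℝ} (hρ : 0 < ρ)
    (hρR : ρ < R) (hu : ‖u‖ = 1) (he : ‖e‖ = 1) (hue : inner ℝ e u = (0 : ℝ)) (hw : ‖w‖ = 1)
    {γ : ℝ → E} (hγ : ∀ θ, γ θ = o + (R * Real.cos θ) • e + (R * Real.sin θ) • u)
    (hsupp : ∀ᶠ z in 𝓝[A] (γ θ₀), ‖z - γ θ₀‖ ^ 2 + 2 * ρ * inner ℝ (z - γ θ₀) w ≤ 0)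
    (hmem : ∀ᶠ θ in 𝓝 θ₀, γ θ ∈ A) : False := by
  have hcont : Continuous γ := by
    rw [funext hγ]
    fun_prop
  have h1 : ∀ᶠ θ in 𝓝 θ₀, ‖γ θ - γ θ₀‖ ^ 2 + 2 * ρ * inner ℝ (γ θ - γ θ₀) w ≤ 0 := by
    rw [eventually_nhdsWithin_iff] at hsupp
    filter_upwards [hcont.continuousAt.eventually hsupp, hmem] with θ a b using a b
  have h2 : ∀ᶠ h in 𝓝 (0 : ℝ),
      ‖γ (θ₀ + h) - γ θ₀‖ ^ 2 + 2 * ρ * inner ℝ (γ (θ₀ + h) - γ θ₀) w ≤ 0 := by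
    have : Tendsto (fun h : ℝ => θ₀ + h) (𝓝 0) (𝓝 θ₀) := by
      have hc : Continuous fun h : ℝ => θ₀ + h := by fun_prop
      simpa using hc.tendsto 0
    exact this.eventually h1
  have h3 : ∀ᶠ h in 𝓝 (0 : ℝ),
      ‖γ (θ₀ - h) - γ θ₀‖ ^ 2 + 2 * ρ * inner ℝ (γ (θ₀ - h) - γ θ₀) w ≤ 0 := by
    have : Tendsto (fun h : ℝ => θ₀ - h) (𝓝 0) (𝓝 θ₀) := by
      have hc : Continuous fun h : ℝ => θ₀ - h := by fun_prop
      simpa using hc.tendsto 0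
    exact this.eventually h1
  obtain ⟨δ, hδ, hball⟩ := Metric.eventually_nhds_iff.1 (h2.and h3)
  obtain ⟨h, hh0, hhδ, hh1⟩ : ∃ h : ℝ, 0 < h ∧ h < δ ∧ h < 1 :=
    ⟨min δ 1 / 2, by positivity, by have := min_le_left δ 1; linarith,
      by have := min_le_right δ 1; linarith⟩
  obtain ⟨i1, i2⟩ := hball (y := h) (by simpa [abs_of_pos hh0] using hhδ)
  have hcos : Real.cos h < 1 := by
    rw [← Real.cos_zero]
    exact Real.cos_lt_cos_of_nonneg_of_le_pi le_rfl (by linarith [Real.pi_gt_three]) hh0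
  have key : ∀ k : ℝ, ‖γ (θ₀ + k) - γ θ₀‖ ^ 2 = 2 * R ^ 2 * (1 - Real.cos k) := by
    intro k
    have : γ (θ₀ + k) - γ θ₀ = (R * (Real.cos (θ₀ + k) - Real.cos θ₀)) • e +
        (R * (Real.sin (θ₀ + k) - Real.sin θ₀)) • u := by
      rw [hγ, hγ]; module
    rw [this, norm_add_sq_real, inner_smul_left, inner_smul_right, hue, norm_smul, norm_smul, hu,
      he, Real.norm_eq_abs, Real.norm_eq_abs, mul_one, mul_one, sq_abs, sq_abs, Real.cos_add,
      Real.sin_add]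
    linear_combination R ^ 2 * (2 * (1 - Real.cos k)) * Real.sin_sq_add_cos_sq θ₀ +
      R ^ 2 * (Real.sin θ₀ ^ 2 + Real.cos θ₀ ^ 2) * Real.sin_sq_add_cos_sq k
  -- In the symmetric second difference the tangential parts cancel, leaving a multiple of the unit
  -- radial vector. Adding the two support inequalities then gives `R ≤ ρ * ⟪radial vector, w⟫ ≤ ρ`.
  have hsum : inner ℝ (γ (θ₀ + h) - γ θ₀) w + inner ℝ (γ (θ₀ - h) - γ θ₀) w =
      -(2 * R * (1 - Real.cos h)) * inner ℝ (Real.cos θ₀ • e + Real.sin θ₀ • u) w := by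
    rw [← inner_add_left, ← real_inner_smul_left]
    congr 1
    rw [hγ, hγ, hγ, Real.cos_add, Real.cos_sub, Real.sin_add, Real.sin_sub]
    module
  have hN : inner ℝ (Real.cos θ₀ • e + Real.sin θ₀ • u) w ≤ 1 := by
    refine (real_inner_le_norm _ _).trans ?_
    rw [hw, mul_one, ← sq_le_one_iff₀ (norm_nonneg _), norm_add_sq_real, inner_smul_left,
      inner_smul_right, hue, norm_smul, norm_smul, hu, he, Real.norm_eq_abs, Real.norm_eq_abs,
      mul_one, mul_one, sq_abs, sq_abs]
    linarith [Real.sin_sq_add_cos_sq θ₀]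
  have k1 := key h
  have k2 := key (-h)
  rw [← sub_eq_add_neg, Real.cos_neg] at k2
  rw [k1] at i1
  rw [k2] at i2
  have hR : 0 < R := hρ.trans hρR
  have hpos : 0 < R * (1 - Real.cos h) := mul_pos hR (by linarith)
  have : R * (1 - Real.cos h) * R ≤
      R * (1 - Real.cos h) * (ρ * inner ℝ (Real.cos θ₀ • e + Real.sin θ₀ • u) w) := by
    have : 2 * ρ * (inner ℝ (γ (θ₀ + h) - γ θ₀) w + inner ℝ (γ (θ₀ - h) - γ θ₀) w) =
      2 * ρ * (-(2 * R * (1 - Real.cos h)) * inner ℝ (Real.cos θ₀ • e + Real.sin θ₀ • u) w) := by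
      rw [hsum]
    linarith
  have := le_of_mul_le_mul_left this hpos
  nlinarith

/-- Continuous induction along a family of curves: if no curve of the family that runs in the
closed set `A` leaves the open set `O`, and the first one runs in `O`, then all run in `O`. -/
theorem forall_mem_of_sweep {X : Type*} [TopologicalSpace X] {f : ℝ × ℝ → X} (hf : Continuous f)
    {O A : Set X} (hO : IsOpen O) (hA : IsClosed A) (hOA : O ⊆ A) {a b c d : ℝ}
    (h0 : ∀ t ∈ Set.Icc c d, f (a, t) ∈ O)
    (h : ∀ s ∈ Set.Icc a b, (∀ t ∈ Set.Icc c d, f (s, t) ∈ A) → ∀ t ∈ Set.Icc c d, f (s, t) ∈ O) :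
    ∀ s ∈ Set.Icc a b, ∀ t ∈ Set.Icc c d, f (s, t) ∈ O := by
  -- The good parameters form a closed set, since by `h` membership in `O` may be replaced by
  -- membership in `A`. They are stable under small increase because `O` is open and `Icc c d`
  -- compact.
  have hsub : Set.Icc a b ⊆ {s | ∀ t ∈ Set.Icc c d, f (s, t) ∈ O} := by
    refine IsClosed.Icc_subset_of_forall_mem_nhdsWithin ?_ h0 ?_
    · have : {s | ∀ t ∈ Set.Icc c d, f (s, t) ∈ O} ∩ Set.Icc a b =
          (⋂ t ∈ Set.Icc c d, {s | f (s, t) ∈ A}) ∩ Set.Icc a b := by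
        ext s
        simp only [Set.mem_inter_iff, Set.mem_ofPred_eq, Set.mem_iInter]
        exact ⟨fun hs => ⟨fun t ht => hOA (hs.1 t ht), hs.2⟩, fun hs => ⟨h s hs.2 hs.1, hs.2⟩⟩
      rw [this]
      refine (isClosed_biInter fun t _ => ?_).inter isClosed_Icc
      exact hA.preimage (hf.comp (by fun_prop : Continuous fun s : ℝ => (s, t)))
    · intro s hs
      apply mem_nhdsWithin_of_mem_nhds
      apply isCompact_Icc.eventually_forall_of_forall_eventually
      intro t ht
      exact hf.continuousAt.eventually (hO.mem_nhds (hs.1 t ht))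
  exact hsub

/-- The set `A` is, near each of its points outside `O`, contained in touching balls of every
radius larger than `r`. -/
def LocallySupported (r : ℝ) (O A : Set E) : Prop :=
  ∀ p ∈ A \ O, ∃ w : E, ‖w‖ = 1 ∧ ∀ R, r < R →
    ∀ᶠ z in 𝓝[A] p, ‖z - p‖ ^ 2 + 2 * R * inner ℝ (z - p) w ≤ 0

namespace LocallySupported

variable {r : ℝ} {O A : Set E}

/-- A touching ball of the intermediate radius `(r + R) / 2` at a point outside `O` would contradict
`not_circle_eventually_mem`. -/
theorem circle_mem (hr : 0 < r) (h : LocallySupported r O A) {R : ℝ} (hR : r < R) {o u e : E}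
    (hu : ‖u‖ = 1) (he : ‖e‖ = 1) (hue : inner ℝ e u = (0 : ℝ)) {θ₀ : ℝ}
    (hmem : ∀ᶠ θ in 𝓝 θ₀, o + (R * Real.cos θ) • e + (R * Real.sin θ) • u ∈ A) :
    o + (R * Real.cos θ₀) • e + (R * Real.sin θ₀) • u ∈ O := by
  by_contra hO
  obtain ⟨w, hw, hsupp⟩ := h _ ⟨hmem.self_of_nhds, hO⟩
  exact not_circle_eventually_mem (γ := fun θ => o + (R * Real.cos θ) • e + (R * Real.sin θ) • u)
    (by linarith : 0 < (r + R) / 2) (by linarith : (r + R) / 2 < R) hu he hue hw (fun _ => rfl)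
    (hsupp _ (by linarith)) hmem

/-- Sweep the segments from `x` to a point moving from `x` to `y` along a path in `O`. At a contact
point, the support inequalities at two symmetric points of the segment add up to a positive square
being nonpositive. -/
theorem convex (h : LocallySupported r O A) (hO : IsOpen O) (hA : IsClosed A) (hOA : O ⊆ A)
    (hconn : IsPathConnected O) : Convex ℝ O := by
  intro x hx y hy
  rw [← segment_subset_iff, segment_eq_image']
  obtain ⟨γ, hγ⟩ := hconn.joinedIn x hx y hy
  have key := forall_mem_of_sweep (f := fun q : ℝ × ℝ => x + q.2 • (γ.extend q.1 - x))
    (by fun_prop) hO hA hOA (a := 0) (b := 1) (c := 0) (d := 1) (by simp [hx]) ?_ 1 (by simp)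
  · rintro _ ⟨t, ht, rfl⟩
    simpa using key t ht
  intro s hs hsA t ht
  rcases ht.1.eq_or_lt with rfl | ht0
  · simpa using hx
  have hyO : γ.extend s ∈ O := by
    rw [Path.extend_apply γ hs]
    exact hγ _
  rcases ht.2.eq_or_lt with rfl | ht1
  · simpa using hyO
  set d := γ.extend s - x with hd
  by_contra hp
  obtain ⟨w, hw, hsupp⟩ := h _ ⟨hsA t ht, hp⟩
  have hd0 : d ≠ 0 := by
    intro h0
    apply hp
    simpa [h0] using hx
  have hev := hsupp (r + 1) (by linarith)
  rw [eventually_nhdsWithin_iff] at hev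
  have hcont : Continuous fun k : ℝ => x + k • d := by fun_prop
  have h1 := (hcont.tendsto t).eventually hev
  obtain ⟨δ, hδ, hball⟩ := Metric.eventually_nhds_iff.1 h1
  obtain ⟨k, hk0, hkδ, hkt, hkt1⟩ : ∃ k : ℝ, 0 < k ∧ k < δ ∧ k < t ∧ k < 1 - t := by
    have hm : 0 < min δ (min t (1 - t)) := by
      simp [hδ, ht0, ht1]
    refine ⟨min δ (min t (1 - t)) / 2, by positivity, ?_, ?_, ?_⟩ <;>
    [have := min_le_left δ (min t (1 - t));
     have := (min_le_right δ (min t (1 - t))).trans (min_le_left _ _);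
     have := (min_le_right δ (min t (1 - t))).trans (min_le_right _ _)] <;> linarith
  have i1 := hball (y := t + k) (by simpa [abs_of_pos hk0] using hkδ)
    (hsA _ ⟨by linarith, by linarith⟩)
  have i2 := hball (y := t - k) (by simpa [abs_of_pos hk0] using hkδ)
    (hsA _ ⟨by linarith, by linarith⟩)
  rw [show x + (t + k) • d - (x + t • d) = k • d by module] at i1
  rw [show x + (t - k) • d - (x + t • d) = -(k • d) by module, norm_neg, inner_neg_left] at i2
  have : 0 < ‖k • d‖ := norm_pos_iff.2 (smul_ne_zero hk0.ne' hd0)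
  nlinarith

/-- The arcs of radius `R` from `x` whose chords grow along `u` are swept: they start at the point
`x`, their endpoints remain in `O` by convexity, and `circle_mem` rules out contact in between. -/
theorem circularArc_mem (hr : 0 < r) (h : LocallySupported r O A) (hO : IsOpen O)
    (hA : IsClosed A) (hOA : O ⊆ A) (hconv : Convex ℝ O) {R : ℝ} (hR : r < R) {x u e : E}
    (hu : ‖u‖ = 1) (he : ‖e‖ = 1) (hue : inner ℝ e u = (0 : ℝ)) {φ : ℝ} (hφ0 : 0 ≤ φ)
    (hφ : φ ≤ Real.pi / 2) (hx : x ∈ O) (hy : x + (2 * R * Real.sin φ) • u ∈ O) {θ : ℝ}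
    (hθ : θ ∈ Set.Icc (-φ) φ) : circularArc x u e R φ θ ∈ O := by
  have hR0 : 0 < R := hr.trans hR
  have key := forall_mem_of_sweep
    -- The angle is rescaled so that the curve parameter runs over the fixed interval `[-1, 1]`.
    (f := fun q : ℝ × ℝ => circularArc x u e R q.1 (q.2 * q.1)) (by unfold circularArc; fun_prop)
    hO hA hOA (a := 0) (b := φ) (c := -1) (d := 1) (by simp [circularArc, hx]) ?_ φ ⟨hφ0, le_rfl⟩
  · rcases hφ0.eq_or_lt with rfl | hφ0
    · have : θ = 0 := by simpa using hθ
      simpa [this, circularArc] using hx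
    · have := key (θ / φ) ⟨by rw [le_div_iff₀ hφ0]; linarith [hθ.1],
        by rw [div_le_iff₀ hφ0]; linarith [hθ.2]⟩
      simpa [div_mul_cancel₀ _ hφ0.ne'] using this
  intro ψ hψ hψA t ht
  rcases ht.1.eq_or_lt with rfl | ht0
  · simpa [circularArc] using hx
  rcases ht.2.eq_or_lt with rfl | ht1
  · have hsin0 : 0 ≤ Real.sin ψ := Real.sin_nonneg_of_nonneg_of_le_pi hψ.1
      (by linarith [hψ.2, Real.pi_pos])
    have hsin : Real.sin ψ ≤ Real.sin φ :=
      Real.sin_le_sin_of_le_of_le_pi_div_two (by linarith [hψ.1, Real.pi_pos]) hφ hψ.2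
    have : circularArc x u e R ψ (1 * ψ) = x + (2 * R * Real.sin ψ) • u := by
      simp only [circularArc, one_mul, sub_self, mul_zero, zero_smul, add_zero]
      module
    simp only [this]
    rcases hsin0.eq_or_lt with h0 | h0
    · simpa [← h0] using hx
    have hmem := hconv.add_smul_mem hx hy
      (t := Real.sin ψ / Real.sin φ) ⟨div_nonneg hsin0 (hsin0.trans hsin), (div_le_one (h0.trans_le hsin)).2 hsin⟩
    rw [smul_smul] at hmem
    convert hmem using 3
    field_simp [(h0.trans_le hsin).ne']
  rcases hψ.1.eq_or_lt with h0 | h0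
  · simpa [circularArc, ← h0] using hx
  simp only
  rw [circularArc_eq]
  apply h.circle_mem hr hR hu he hue
  have : ∀ᶠ θ' in 𝓝 (t * ψ), θ' ∈ Set.Ioo (-ψ) ψ :=
    isOpen_Ioo.mem_nhds ⟨by nlinarith, by nlinarith⟩
  filter_upwards [this] with θ' hθ'
  have := hψA (θ' / ψ) ⟨by rw [le_div_iff₀ h0]; linarith [hθ'.1],
        by rw [div_le_iff₀ h0]; linarith [hθ'.2]⟩
  simp only [div_mul_cancel₀ _ h0.ne'] at this
  rwa [circularArc_eq] at this

/-- Otherwise `O` contains a chord of length `2 * R`, hence two half-circles forming a full circle.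
Concentric circles can then be inflated without ever leaving `O`, against boundedness. -/
theorem dist_lt (hr : 0 < r) (h : LocallySupported r O A) (hO : IsOpen O)
    (hA : IsClosed A) (hOA : O ⊆ A) (hconv : Convex ℝ O) (hbdd : Bornology.IsBounded O)
    (hperp : ∀ u : E, ∃ e : E, ‖e‖ = 1 ∧ inner ℝ e u = (0 : ℝ)) {R : ℝ} (hR : r < R) {x y : E}
    (hx : x ∈ O) (hy : y ∈ O) : ‖y - x‖ < 2 * R := by
  have hR0 : 0 < R := hr.trans hR
  by_contra! hxy
  have hd : 0 < ‖y - x‖ := by linarith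
  obtain ⟨u, hu, hyu⟩ : ∃ u : E, ‖u‖ = 1 ∧ ‖y - x‖ • u = y - x :=
    ⟨‖y - x‖⁻¹ • (y - x), by rw [norm_smul, norm_inv, norm_norm, inv_mul_cancel₀ hd.ne'], by rw [smul_inv_smul₀ hd.ne']⟩
  obtain ⟨e, he, hue⟩ := hperp u
  have hy' : x + (2 * R * Real.sin (Real.pi / 2)) • u ∈ O := by
    have := hconv.add_smul_mem hx (y := y - x) (by simpa using hy)
      (t := 2 * R / ‖y - x‖) ⟨by positivity, (div_le_one hd).2 hxy⟩
    rw [← hyu, smul_smul, hyu, div_mul_cancel₀ _ hd.ne'] at this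
    simpa using this
  have harc : ∀ e : E, ‖e‖ = 1 → inner ℝ e u = (0 : ℝ) →
      ∀ θ ∈ Set.Icc (-(Real.pi / 2)) (Real.pi / 2),
        (x + R • u) + (R * Real.cos θ) • e + (R * Real.sin θ) • u ∈ O := by
    intro e he hue θ hθ
    have := h.circularArc_mem hr hO hA hOA hconv hR hu he hue (by positivity) le_rfl hx hy' hθ
    rw [circularArc_eq] at this
    simpa using this
  have hper : ∀ ρ : ℝ, Function.Periodic
      (fun θ => (x + R • u) + (ρ * Real.cos θ) • e + (ρ * Real.sin θ) • u) (2 * Real.pi) := by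
    intro ρ θ
    simp
  obtain ⟨M, hM⟩ := hbdd.exists_norm_le
  have hM0 : 0 ≤ M := (norm_nonneg x).trans (hM x hx)
  set b := R + M + ‖x + R • u‖ + 1 with hb
  have key := forall_mem_of_sweep
    (f := fun q : ℝ × ℝ => (x + R • u) + (q.1 * Real.cos q.2) • e + (q.1 * Real.sin q.2) • u)
    (by fun_prop) hO hA hOA (a := R) (b := b)
    (c := -(Real.pi / 2)) (d := -(Real.pi / 2) + 2 * Real.pi) ?_ ?_ b
    ⟨by linarith [norm_nonneg (x + R • u)], le_rfl⟩ 0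
    ⟨by linarith [Real.pi_pos], by linarith [Real.pi_pos]⟩
  · have h1 := hM _ key
    simp only [Real.cos_zero, Real.sin_zero, mul_one, mul_zero, zero_smul, add_zero] at h1
    have h2 : ‖b • e‖ ≤ ‖x + R • u + b • e‖ + ‖x + R • u‖ := by
      have := norm_sub_le (x + R • u + b • e) (x + R • u)
      rwa [add_sub_cancel_left] at this
    rw [norm_smul, he, mul_one, Real.norm_eq_abs] at h2
    have := le_abs_self b
    linarith
  · intro θ hθ
    rcases le_total θ (Real.pi / 2) with hle | hle
    · exact harc e he hue θ ⟨hθ.1, hle⟩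
    · have := harc (-e) (by simpa using he) (by simpa using hue) (Real.pi - θ)
        ⟨by linarith [hθ.2], by linarith⟩
      simpa using this
  · intro ρ hρ hρA θ hθ
    refine h.circle_mem hr (hR.trans_le hρ.1) hu he hue (Eventually.of_forall fun θ' => ?_)
    -- Periodicity provides a two-sided neighbourhood of every angle, including the ends of the
    -- parameter interval.
    obtain ⟨θ'', hθ'', heq⟩ := (hper ρ).exists_mem_Ico Real.two_pi_pos θ' (-(Real.pi / 2))
    rw [heq]
    exact hρA θ'' ⟨hθ''.1, hθ''.2.le⟩

end LocallySupported

/-- If the arcs of radius `R` from `p` to `y` lie in the half-space with outer normal `w`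
through `p`, then `y` lies in the ball of radius `R` that touches this half-space at `p`. -/
theorem norm_sq_add_inner_nonpos_of_circularArc {p y w u : E} {R φ : ℝ} (hR : 0 < R)
    (hw : ‖w‖ = 1) (hu : ‖u‖ = 1) (hφ0 : 0 < φ) (hφ : φ ≤ Real.pi / 2)
    (hy : y - p = (2 * R * Real.sin φ) • u) (hyw : inner ℝ (y - p) w ≤ (0 : ℝ))
    (harc : ∀ e : E, ‖e‖ = 1 → inner ℝ e u = (0 : ℝ) → ∀ θ ∈ Set.Icc (-φ) φ,
      inner ℝ (circularArc p u e R φ θ - p) w ≤ (0 : ℝ)) :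
    ‖y - p‖ ^ 2 + 2 * R * inner ℝ (y - p) w ≤ 0 := by
  have hsin : 0 < Real.sin φ := Real.sin_pos_of_pos_of_lt_pi hφ0 (by linarith [Real.pi_pos])
  have hcos : 0 ≤ Real.cos φ := Real.cos_nonneg_of_mem_Icc ⟨by linarith [Real.pi_pos], hφ⟩
  set a : ℝ := inner ℝ u w with ha
  have hpos : 0 < 2 * R * Real.sin φ := by positivity
  have ha0 : a ≤ 0 := by
    rw [hy, real_inner_smul_left] at hyw
    exact nonpos_of_mul_nonpos_right hyw hpos
  suffices hs : Real.sin φ ≤ -a by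
    rw [hy, norm_smul, hu, real_inner_smul_left, Real.norm_eq_abs, mul_one, sq_abs, ← ha]
    nlinarith
  have horth : inner ℝ (w - a • u) u = (0 : ℝ) := by
    rw [inner_sub_left, real_inner_smul_left, real_inner_self_eq_norm_sq, hu, real_inner_comm, ← ha]
    ring
  have hnorm : ‖w - a • u‖ ^ 2 = 1 - a ^ 2 := by
    rw [norm_sub_sq_real, real_inner_smul_right, real_inner_comm, ← ha, norm_smul, hw, hu,
      Real.norm_eq_abs, mul_one, sq_abs]
    ring
  set b := ‖w - a • u‖ with hb
  have hsa : Real.sin φ ^ 2 ≤ a ^ 2 := by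
    rcases (norm_nonneg (w - a • u)).eq_or_lt with h0 | h0
    · have : b ^ 2 = 0 := by rw [hb, ← h0]; ring
      nlinarith [Real.sin_sq_le_one φ]
    rw [← hb] at h0
    have he : ‖b⁻¹ • (w - a • u)‖ = 1 := by rw [norm_smul, norm_inv, norm_norm, inv_mul_cancel₀ h0.ne']
    have hew : inner ℝ (b⁻¹ • (w - a • u)) w = b := by
      rw [real_inner_smul_left, inner_sub_left, real_inner_smul_left, real_inner_self_eq_norm_sq,
        hw, ← ha, show (1 : ℝ) ^ 2 - a * a = b ^ 2 by rw [hnorm]; ring]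
      field_simp
    -- The chord from `p` to the arc point at angle `φ - 2 * ψ` has direction `cos ψ • u + sin ψ •
    -- e`, with `e` the normalized part of `w` orthogonal to `u`. As `ψ → φ` it becomes tangent to
    -- the arc at `p`.
    have key : ∀ ψ ∈ Set.Ioo 0 φ, Real.cos ψ * a + Real.sin ψ * b ≤ 0 := by
      intro ψ hψ
      have h1 := harc _ he (by rw [real_inner_smul_left, horth, mul_zero]) (φ - 2 * ψ)
        ⟨by linarith [hψ.2], by linarith [hψ.1]⟩
      have h2 : 0 < Real.sin (φ - ψ) := Real.sin_pos_of_pos_of_lt_pi (by linarith [hψ.2])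
        (by linarith [hψ.1, Real.pi_pos])
      rw [circularArc, add_assoc, add_sub_cancel_left, inner_add_left, real_inner_smul_left,
        real_inner_smul_left, hew, ← ha] at h1
      have h3 : Real.sin (φ - 2 * ψ) + Real.sin φ = 2 * Real.sin (φ - ψ) * Real.cos ψ := by
        rw [show φ - 2 * ψ = (φ - ψ) - ψ by ring]
        nth_rw 2 [show φ = (φ - ψ) + ψ by ring]
        rw [Real.sin_sub (φ - ψ), Real.sin_add (φ - ψ)]
        ring
      have h4 : Real.cos (φ - 2 * ψ) - Real.cos φ = 2 * Real.sin (φ - ψ) * Real.sin ψ := by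
        rw [show φ - 2 * ψ = (φ - ψ) - ψ by ring]
        nth_rw 2 [show φ = (φ - ψ) + ψ by ring]
        rw [Real.cos_sub (φ - ψ), Real.cos_add (φ - ψ)]
        ring
      rw [h3, h4] at h1
      have h5 : 2 * R * Real.sin (φ - ψ) * (Real.cos ψ * a + Real.sin ψ * b) ≤ 0 := by linarith
      exact nonpos_of_mul_nonpos_right h5 (by positivity)
    have hlim : Real.cos φ * a + Real.sin φ * b ≤ 0 := by
      have hc : Continuous fun ψ : ℝ => Real.cos ψ * a + Real.sin ψ * b := by fun_prop
      refine le_of_tendsto (hc.continuousWithinAt (s := Set.Iio φ) (x := φ)) ?_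
      filter_upwards [Ioo_mem_nhdsLT hφ0] with ψ hψ using key ψ hψ
    have h6 : (Real.sin φ * b) ^ 2 ≤ (Real.cos φ * a) ^ 2 := by
      rw [← neg_sq (Real.cos φ * a)]
      exact pow_le_pow_left₀ (by positivity) (by linarith) 2
    have h7 := Real.sin_sq_add_cos_sq φ
    have : Real.cos φ ^ 2 = 1 - Real.sin φ ^ 2 := by linarith
    rw [mul_pow, mul_pow, hnorm, this] at h6
    linarith
  nlinarith

/-- A pair of distinct points at distance at most `2 * R` in terms of the angle of the arc of
radius `R` that joins them. -/
theorem exists_angle {p y : E} {R : ℝ} (hR : 0 < R) (hne : y ≠ p) (hd : ‖y - p‖ ≤ 2 * R) :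
    ∃ u : E, ∃ φ : ℝ, ‖u‖ = 1 ∧ 0 < φ ∧ φ ≤ Real.pi / 2 ∧ y - p = (2 * R * Real.sin φ) • u := by
  have h0 : 0 < ‖y - p‖ := norm_pos_iff.2 (sub_ne_zero.2 hne)
  refine ⟨‖y - p‖⁻¹ • (y - p), Real.arcsin (‖y - p‖ / (2 * R)), by rw [norm_smul, norm_inv, norm_norm, inv_mul_cancel₀ h0.ne'],
    Real.arcsin_pos.2 (by positivity), Real.arcsin_le_pi_div_two _, ?_⟩
  rw [Real.sin_arcsin (by linarith [show 0 < ‖y - p‖ / (2 * R) by positivity])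
    ((div_le_one (by positivity)).2 hd), mul_div_cancel₀ _ (by positivity), smul_inv_smul₀ h0.ne']

namespace LocallySupported

variable {r : ℝ} {O A : Set E}

/-- The local normal `w` already serves globally: convexity spreads the half-space condition to all
of `A`, and the arcs of radius `R > r` from `p` to points of `O` lie in `A`, hence in that
half-space. -/
theorem norm_sq_add_inner_nonpos (hr : 0 < r) (h : LocallySupported r O A) (hO : IsOpen O)
    (hA : IsClosed A) (hOA : O ⊆ A) (hAO : A ⊆ closure O) (hconn : IsPathConnected O)
    (hbdd : Bornology.IsBounded O) (hperp : ∀ u : E, ∃ e : E, ‖e‖ = 1 ∧ inner ℝ e u = (0 : ℝ))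
    {p : E} (hp : p ∈ A \ O) :
    ∃ w : E, ‖w‖ = 1 ∧ ∀ y ∈ A, ‖y - p‖ ^ 2 + 2 * r * inner ℝ (y - p) w ≤ 0 := by
  have hconv := h.convex hO hA hOA hconn
  have hcl : A = closure O := hAO.antisymm (closure_minimal hOA hA)
  have hAconv : Convex ℝ A := hcl ▸ hconv.closure
  obtain ⟨w, hw, hsupp⟩ := h p hp
  refine ⟨w, hw, ?_⟩
  have hhalf : ∀ y ∈ A, inner ℝ (y - p) w ≤ (0 : ℝ) := by
    intro y hy
    have hev := hsupp (r + 1) (by linarith)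
    rw [eventually_nhdsWithin_iff] at hev
    have hc : Continuous fun k : ℝ => p + k • (y - p) := by fun_prop
    have h1 : ∀ᶠ k in 𝓝 (0 : ℝ), _ := hc.continuousAt.eventually (by simpa using hev)
    have h2 : ∀ᶠ k in 𝓝[>] (0 : ℝ), k ∈ Set.Ioo (0 : ℝ) 1 := Ioo_mem_nhdsGT one_pos
    obtain ⟨k, hk1, hk⟩ := ((h1.filter_mono nhdsWithin_le_nhds).and h2).exists
    have := hk1 (hAconv.add_smul_sub_mem hp.1 hy ⟨hk.1.le, hk.2.le⟩)
    rw [add_sub_cancel_left, real_inner_smul_left] at this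
    have h3 : 2 * (r + 1) * k * inner ℝ (y - p) w ≤ 0 := by nlinarith [sq_nonneg ‖k • (y - p)‖]
    exact nonpos_of_mul_nonpos_right h3 (by have := hk.1; positivity)
  have hmain : ∀ R, r < R → ∀ y ∈ O, ‖y - p‖ ^ 2 + 2 * R * inner ℝ (y - p) w ≤ 0 := by
    intro R hR y hy
    have hR0 : 0 < R := hr.trans hR
    have hne : y ≠ p := fun h => hp.2 (h ▸ hy)
    have hd : ‖y - p‖ ≤ 2 * R := by
      have : A ⊆ Metric.closedBall y (2 * R) := by
        rw [hcl]
        refine closure_minimal (fun x hx => ?_) Metric.isClosed_closedBall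
        rw [mem_closedBall_iff_norm]
        exact (h.dist_lt hr hO hA hOA hconv hbdd hperp hR hy hx).le
      rw [← norm_neg, neg_sub, ← mem_closedBall_iff_norm]
      exact this hp.1
    obtain ⟨u, φ, hu, hφ0, hφ, hyu⟩ := exists_angle hR0 hne hd
    refine norm_sq_add_inner_nonpos_of_circularArc hR0 hw hu hφ0 hφ hyu (hhalf y (hOA hy)) ?_
    intro e he hue θ hθ
    apply hhalf
    rcases hθ.1.eq_or_lt with rfl | hθ1
    · simpa [circularArc] using hp.1
    rcases hθ.2.eq_or_lt with rfl | hθ2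
    · have : circularArc p u e R θ θ = y := by
        rw [← sub_add_cancel y p, hyu]
        simp only [circularArc, sub_self, mul_zero, zero_smul, add_zero]
        module
      exact this ▸ hOA hy
    -- As `p` is not in `O`, the arc is approximated by arcs that end at `y` and start on the open
    -- segment from `p` to `y`, which lies in `O`.
    have hc : Continuous fun ψ : ℝ =>
        circularArc (p + (2 * R * (Real.sin φ - Real.sin ψ)) • u) u e R ψ θ := by
      unfold circularArc; fun_prop
    have hlim := hc.continuousWithinAt (s := Set.Iio φ) (x := φ)
    simp only [ContinuousWithinAt, sub_self, mul_zero, zero_smul, add_zero] at hlim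
    refine hA.mem_of_tendsto hlim ?_
    filter_upwards [Ioo_mem_nhdsLT (max_lt hφ0 (max_lt hθ2 (neg_lt.1 hθ1)))] with ψ hψ
    have hψ0 : 0 < ψ := (le_max_left _ _).trans_lt hψ.1
    have hψ1 : θ < ψ := ((le_max_left _ _).trans (le_max_right _ _)).trans_lt hψ.1
    have hψ2 : -θ < ψ := ((le_max_right _ _).trans (le_max_right _ _)).trans_lt hψ.1
    have hsin0 : 0 < Real.sin ψ :=
      Real.sin_pos_of_pos_of_lt_pi hψ0 (by linarith [Real.pi_pos, hψ.2])
    have hsin : Real.sin ψ < Real.sin φ :=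
      Real.sin_lt_sin_of_lt_of_le_pi_div_two (by linarith [Real.pi_pos]) hφ hψ.2
    refine hOA (h.circularArc_mem hr hO hA hOA hconv hR hu he hue hψ0.le
      (hψ.2.le.trans hφ) ?_ ?_ ⟨by linarith, hψ1.le⟩)
    · have := hconv.openSegment_closure_interior_subset_interior (x := p) (y := y)
        (hAO hp.1) (by rwa [hO.interior_eq])
      rw [hO.interior_eq, openSegment_eq_image'] at this
      refine this ⟨1 - Real.sin ψ / Real.sin φ, ⟨?_, ?_⟩, ?_⟩
      · rw [sub_pos, div_lt_one (hsin0.trans hsin)]; exact hsin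
      · have := div_pos hsin0 (hsin0.trans hsin)
        linarith
      · simp only [hyu, smul_smul]
        congr 2
        field_simp [(hsin0.trans hsin).ne']
    · have : p + (2 * R * (Real.sin φ - Real.sin ψ)) • u + (2 * R * Real.sin ψ) • u = y := by
        rw [← sub_add_cancel y p, hyu]
        module
      rwa [this]
  intro y hy
  have hO' : ∀ y ∈ O, ‖y - p‖ ^ 2 + 2 * r * inner ℝ (y - p) w ≤ 0 := by
    intro y hy
    have hc : Continuous fun R : ℝ => ‖y - p‖ ^ 2 + 2 * R * inner ℝ (y - p) w := by fun_prop
    refine le_of_tendsto (hc.continuousWithinAt (s := Set.Ioi r) (x := r)) ?_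
    filter_upwards [self_mem_nhdsWithin] with R hR using hmain R hR y hy
  have hclosed : IsClosed {y : E | ‖y - p‖ ^ 2 + 2 * r * inner ℝ (y - p) w ≤ 0} :=
    isClosed_le (by fun_prop) continuous_const
  exact closure_minimal hO' hclosed (hAO hy)

end LocallySupported

end Geometry

/-! ### `r`-convex sets and their supporting balls -/

section RConvex

theorem circularArc_mem_closedBall {E : Type*} [NormedAddCommGroup E] [InnerProductSpace ℝ E]
    {x u e c : E} {R φ θ : ℝ} (hR : 0 < R) (hu : ‖u‖ = 1) (he : ‖e‖ = 1)
    (hue : inner ℝ e u = (0 : ℝ)) (hφ0 : 0 < φ) (hφ : φ ≤ Real.pi / 2)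
    (hx : x ∈ Metric.closedBall c R) (hy : x + (2 * R * Real.sin φ) • u ∈ Metric.closedBall c R)
    (hθ : θ ∈ Set.Icc (-φ) φ) : circularArc x u e R φ θ ∈ Metric.closedBall c R := by
  set o := x + (R * Real.sin φ) • u - (R * Real.cos φ) • e with ho
  set a : ℝ := inner ℝ (o - c) e with ha
  set b : ℝ := inner ℝ (o - c) u with hb
  have key : ∀ ψ, circularArc x u e R φ ψ ∈ Metric.closedBall c R ↔
      ‖o - c‖ ^ 2 + 2 * R * (Real.cos ψ * a + Real.sin ψ * b) ≤ 0 := by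
    intro ψ
    rw [mem_closedBall_iff_norm, ← sq_le_sq₀ (norm_nonneg _) hR.le, circularArc_eq, ← ho,
      show o + (R * Real.cos ψ) • e + (R * Real.sin ψ) • u - c =
        (o - c) + ((R * Real.cos ψ) • e + (R * Real.sin ψ) • u) by abel, norm_add_sq_real,
      norm_add_sq_real, inner_add_right, real_inner_smul_right, real_inner_smul_right,
      real_inner_smul_left, real_inner_smul_right, hue, norm_smul, norm_smul, hu, he,
      Real.norm_eq_abs, Real.norm_eq_abs, mul_one, mul_one, sq_abs, sq_abs, ← ha, ← hb]
    have := Real.sin_sq_add_cos_sq ψ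
    constructor <;> intro h <;> nlinarith
  have h1 := (key (-φ)).1 (by simpa [circularArc] using hx)
  have h2 := (key φ).1 (by
    have : circularArc x u e R φ φ = x + (2 * R * Real.sin φ) • u := by
      simp only [circularArc, sub_self, mul_zero, zero_smul, add_zero]
      module
    rwa [this])
  rw [key]
  rw [Real.cos_neg, Real.sin_neg] at h1
  rcases hφ.eq_or_lt with h | h
  · rw [h, Real.cos_pi_div_two, Real.sin_pi_div_two] at h1 h2
    have : ‖o - c‖ = 0 := by
      have : ‖o - c‖ ^ 2 ≤ 0 := by linarith
      exact pow_eq_zero_iff two_ne_zero |>.1 (this.antisymm (sq_nonneg _))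
    rw [norm_eq_zero] at this
    simp [ha, hb, this]
  · have hs : 0 < Real.sin φ := Real.sin_pos_of_pos_of_lt_pi hφ0 (by linarith [Real.pi_pos])
    have hc : 0 < Real.cos φ := Real.cos_pos_of_mem_Ioo ⟨by linarith [Real.pi_pos], h⟩
    have hp : 0 ≤ Real.sin (φ + θ) := Real.sin_nonneg_of_nonneg_of_le_pi
      (by linarith [hθ.1]) (by linarith [hθ.2])
    have hm : 0 ≤ Real.sin (φ - θ) := Real.sin_nonneg_of_nonneg_of_le_pi
      (by linarith [hθ.2]) (by linarith [hθ.1])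
    have hcos : Real.cos φ ≤ Real.cos θ := by
      rw [← Real.cos_abs θ]
      exact Real.cos_le_cos_of_nonneg_of_le_pi (abs_nonneg _) (by linarith) (abs_le.2 hθ)
    -- The endpoint inequalities are combined with weights `sin (φ + θ)` and `sin (φ - θ)`, which
    -- reproduce `cos θ` and `sin θ` up to the factor `2 * sin φ * cos φ`; the constant term is
    -- controlled by `cos φ ≤ cos θ`.
    have h3 := mul_nonpos_of_nonneg_of_nonpos hp h2
    have h4 := mul_nonpos_of_nonneg_of_nonpos hm h1
    have h5 : 2 * (Real.sin φ * ‖o - c‖ ^ 2) * Real.cos φ ≤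
        2 * (Real.sin φ * ‖o - c‖ ^ 2) * Real.cos θ :=
      mul_le_mul_of_nonneg_left hcos (by positivity)
    rw [Real.sin_add] at h3
    rw [Real.sin_sub] at h4
    have h6 : 2 * Real.sin φ * Real.cos φ *
        (‖o - c‖ ^ 2 + 2 * R * (Real.cos θ * a + Real.sin θ * b)) ≤ 0 := by
      linarith
    exact nonpos_of_mul_nonpos_right h6 (by positivity)

theorem exists_unit_orthogonal {n : ℕ} (hn : 2 ≤ n) (u : EuclideanSpace ℝ (Fin n)) :
    ∃ e : EuclideanSpace ℝ (Fin n), ‖e‖ = 1 ∧ inner ℝ e u = (0 : ℝ) := by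
  have hlt : (ℝ ∙ u) < ⊤ := by
    refine lt_top_iff_ne_top.2 fun h => ?_
    have h1 := finrank_span_le_card (R := ℝ) ({u} : Set (EuclideanSpace ℝ (Fin n)))
    rw [Set.toFinset_singleton, Finset.card_singleton] at h1
    rw [h, finrank_top, finrank_euclideanSpace_fin] at h1
    omega
  have hne : (ℝ ∙ u)ᗮ ≠ ⊥ := fun h => hlt.ne (Submodule.orthogonal_eq_bot_iff.1 h)
  obtain ⟨e, he, he0⟩ := Submodule.exists_mem_ne_zero_of_ne_bot hne
  have h0 := norm_pos_iff.2 he0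
  refine ⟨‖e‖⁻¹ • e, by rw [norm_smul, norm_inv, norm_norm, inv_mul_cancel₀ h0.ne'], ?_⟩
  rw [real_inner_smul_left, real_inner_comm, Submodule.mem_orthogonal_singleton_iff_inner_right.1 he,
    mul_zero]

namespace IsRConvex

variable {n : ℕ} {s : ℝ} {Ω : Set (EuclideanSpace ℝ (Fin n))}

theorem mem (h : IsRConvex s Ω) {x y z : EuclideanSpace ℝ (Fin n)} (hx : x ∈ Ω) (hy : y ∈ Ω)
    (hz : ∀ c, x ∈ Metric.closedBall c s → y ∈ Metric.closedBall c s → z ∈ Metric.closedBall c s) :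
    z ∈ Ω :=
  h x hx y hy (Set.mem_iInter₂.2 fun c hc => hz c hc.1 hc.2)

theorem norm_sub_le (h : IsRConvex s Ω) (hΩ : Ω ≠ Set.univ) {x y : EuclideanSpace ℝ (Fin n)}
    (hx : x ∈ Ω) (hy : y ∈ Ω) : ‖y - x‖ ≤ 2 * s := by
  by_contra! hlt
  refine hΩ (Set.eq_univ_of_forall fun z => h.mem hx hy fun c hc hc' => ?_)
  rw [mem_closedBall_iff_norm] at hc hc'
  have := _root_.norm_sub_le (y - c) (x - c)
  rw [sub_sub_sub_cancel_right] at this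
  linarith

theorem isBounded (h : IsRConvex s Ω) (hΩ : Ω ≠ Set.univ) : Bornology.IsBounded Ω := by
  rw [Metric.isBounded_iff]
  exact ⟨2 * s, fun x hx y hy => by rw [dist_eq_norm]; exact h.norm_sub_le hΩ hy hx⟩

theorem convex (h : IsRConvex s Ω) : Convex ℝ Ω := by
  intro x hx y hy
  rw [← segment_subset_iff]
  intro z hz
  exact h.mem hx hy fun c hc hc' => (convex_closedBall c s).segment_subset hc hc' hz

/-- Every ball of radius `s` containing `x` and `y` contains the short arcs of radius `s` joining
them, so these arcs lie in `Ω` and in the half-space of `v`. -/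
theorem norm_sq_add_inner_nonpos (h : IsRConvex s Ω) (hs : 0 < s) (hΩ : Ω ≠ Set.univ)
    {x y v : EuclideanSpace ℝ (Fin n)} (hx : x ∈ Ω) (hv : IsUnitNormal Ω x v) (hy : y ∈ Ω) :
    ‖y - x‖ ^ 2 + 2 * s * inner ℝ (y - x) v ≤ 0 := by
  rcases eq_or_ne y x with rfl | hne
  · simp
  obtain ⟨u, φ, hu, hφ0, hφ, hyu⟩ := exists_angle hs hne (h.norm_sub_le hΩ hx hy)
  have hhalf : ∀ z ∈ Ω, inner ℝ (z - x) v ≤ (0 : ℝ) := fun z hz => by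
    rw [real_inner_comm]; exact hv.2.2 z hz
  refine norm_sq_add_inner_nonpos_of_circularArc hs hv.2.1 hu hφ0 hφ hyu (hhalf y hy) ?_
  intro e he hue θ hθ
  refine hhalf _ (h.mem hx hy fun c hc hc' => ?_)
  refine circularArc_mem_closedBall hs hu he hue hφ0 hφ hc ?_ hθ
  rwa [← hyu, add_sub_cancel]

/-- By the parallelogram law, the centres of all balls of radius `s` through the pair stay at
distance less than `s`, uniformly, from the midpoint. -/
theorem nonempty_interior (h : IsRConvex s Ω) (hs : 0 < s) (hnt : Ω.Nontrivial) :
    (interior Ω).Nonempty := by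
  obtain ⟨x, hx, y, hy, hne⟩ := hnt
  set m := (1 / 2 : ℝ) • (x + y) with hm
  have hd : 0 < ‖x - y‖ := norm_pos_iff.2 (sub_ne_zero.2 hne)
  have hlt : √(s ^ 2 - (‖x - y‖ / 2) ^ 2) < s := by
    rw [Real.sqrt_lt' hs]
    have : 0 < (‖x - y‖ / 2) ^ 2 := by positivity
    linarith
  refine ⟨m, mem_interior.2 ⟨Metric.ball m (s - √(s ^ 2 - (‖x - y‖ / 2) ^ 2)), fun z hz =>
    h.mem hx hy fun c hc hc' => ?_, Metric.isOpen_ball, Metric.mem_ball_self (by linarith)⟩⟩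
  rw [mem_ball_iff_norm] at hz
  rw [mem_closedBall_iff_norm] at *
  have hmc : ‖m - c‖ ≤ √(s ^ 2 - (‖x - y‖ / 2) ^ 2) := by
    apply Real.le_sqrt_of_sq_le
    have h1 := parallelogram_law_with_norm ℝ (x - c) (y - c)
    rw [show x - c + (y - c) = (2 : ℝ) • (m - c) by rw [hm]; module, sub_sub_sub_cancel_right,
      norm_smul, Real.norm_ofNat] at h1
    have h2 := pow_le_pow_left₀ (norm_nonneg _) hc 2
    have h3 := pow_le_pow_left₀ (norm_nonneg _) hc' 2
    nlinarith
  have := norm_add_le (z - m) (m - c)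
  rw [sub_add_sub_cancel] at this
  linarith

end IsRConvex

/-- A closed set that is contained in a touching ball of radius `r` at each point outside an open
nonempty subset is `r`-convex. -/
theorem isRConvex_of_supported {n : ℕ} {r : ℝ} (hr : 0 < r)
    {O A : Set (EuclideanSpace ℝ (Fin n))} (hO : IsOpen O) (hA : IsClosed A) (hOA : O ⊆ A)
    (hne : O.Nonempty)
    (hsupp : ∀ p ∈ A \ O, ∃ w : EuclideanSpace ℝ (Fin n), ‖w‖ = 1 ∧
      ∀ y ∈ A, ‖y - p‖ ^ 2 + 2 * r * inner ℝ (y - p) w ≤ 0) : IsRConvex r A := by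
  intro a ha b hb z hz
  by_contra hzA
  obtain ⟨q, hq⟩ := hne
  set f : ℝ → EuclideanSpace ℝ (Fin n) := fun t => q + t • (z - q) with hf
  have hfc : Continuous f := by fun_prop
  set T : Set ℝ := Set.Icc 0 1 ∩ f ⁻¹' A with hT
  have hTc : IsCompact T := isCompact_Icc.inter_right (hA.preimage hfc)
  have h0T : (0 : ℝ) ∈ T := ⟨by simp, by simpa [hf] using hOA hq⟩
  -- At the last point of `A` on the segment from `q` to `z`, the touching ball contains `z` and has
  -- `q` in its interior. The exit point would then be interior to the ball, yet it lies on its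
  -- sphere.
  obtain ⟨t, htT, htmax⟩ := hTc.exists_isGreatest ⟨0, h0T⟩
  have ht1 : t < 1 := by
    refine lt_of_le_of_ne htT.1.2 ?_
    rintro rfl
    exact hzA (by simpa [hf] using htT.2)
  have htO : f t ∉ O := by
    intro hmem
    have h1 : ∀ᶠ k in 𝓝[>] t, f k ∈ O :=
      (hfc.continuousAt.eventually (hO.mem_nhds hmem)).filter_mono nhdsWithin_le_nhds
    obtain ⟨k, hkO, hk⟩ := (h1.and (Ioo_mem_nhdsGT ht1)).exists
    exact hk.1.not_ge (htmax ⟨⟨htT.1.1.trans hk.1.le, hk.2.le⟩, hOA hkO⟩)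
  have ht0 : 0 < t := by
    refine lt_of_le_of_ne htT.1.1 ?_
    rintro rfl
    exact htO (by simpa [hf] using hq)
  obtain ⟨w, hw, hball⟩ := hsupp _ ⟨htT.2, htO⟩
  have hsub : A ⊆ Metric.closedBall (f t - r • w) r := fun y hy =>
    (mem_closedBall_sub_smul_iff hr.le hw).2 (hball y hy)
  have hzB : z ∈ Metric.closedBall (f t - r • w) r :=
    Set.mem_iInter₂.1 hz _ ⟨hsub ha, hsub hb⟩
  have hqB : q ∈ interior (Metric.closedBall (f t - r • w) r) :=
    interior_mono hsub (interior_mono hOA (by rwa [hO.interior_eq]))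
  have hft := (convex_closedBall (f t - r • w) r).openSegment_interior_self_subset_interior hqB hzB
    (by rw [openSegment_eq_image']; exact ⟨t, ⟨ht0, ht1⟩, rfl⟩ : f t ∈ openSegment ℝ q z)
  rw [interior_closedBall _ hr.ne', mem_ball_iff_norm, sub_sub_cancel, norm_smul, hw,
    Real.norm_eq_abs, abs_of_pos hr, mul_one] at hft
  exact lt_irrefl _ hft

theorem isRConvex_singleton {n : ℕ} {r : ℝ} (hr : 0 < r) (p : EuclideanSpace ℝ (Fin n)) :
    IsRConvex r {p} := by
  rintro a rfl b rfl z hz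
  by_contra hne
  have h0 : 0 < ‖z - b‖ := norm_pos_iff.2 (sub_ne_zero.2 hne)
  set w := ‖z - b‖⁻¹ • (z - b) with hw
  have hw1 : ‖w‖ = 1 := by rw [hw, norm_smul, norm_inv, norm_norm, inv_mul_cancel₀ h0.ne']
  have hb : b ∈ Metric.closedBall (b - r • w) r :=
    (mem_closedBall_sub_smul_iff hr.le hw1).2 (by simp)
  have h1 := (mem_closedBall_sub_smul_iff hr.le hw1).1 (Set.mem_iInter₂.1 hz _ ⟨hb, hb⟩)
  rw [hw, real_inner_smul_right, real_inner_self_eq_norm_sq] at h1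
  have : 0 < ‖z - b‖ ^ 2 + 2 * r * (‖z - b‖⁻¹ * ‖z - b‖ ^ 2) := by positivity
  linarith

end RConvex

/-! ### Second-order estimates for the image near a boundary point -/

section SecondOrder

variable {E : Type*} [NormedAddCommGroup E] [InnerProductSpace ℝ E]

theorem norm_image_sub_sub_fderiv_le {Φ : E → E} {U : Set E} {x : E} {K : ℝ≥0} {ρ : ℝ}
    (hU : IsOpen U) (hΦ : DifferentiableOn ℝ Φ U) (hK : LipschitzOnWith K (fderiv ℝ Φ) U)
    (hρ : Metric.closedBall x ρ ⊆ U) {y z : E} (hy : y ∈ Metric.closedBall x ρ)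
    (hz : z ∈ Metric.closedBall x ρ) :
    ‖Φ z - Φ y - fderiv ℝ Φ x (z - y)‖ ≤ K * ρ * ‖z - y‖ := by
  have hρ0 : 0 ≤ ρ := dist_nonneg.trans hy
  refine Convex.norm_image_sub_le_of_norm_hasFDerivWithin_le' (f' := fderiv ℝ Φ)
    (fun w hw => ((hΦ w (hρ hw)).differentiableAt
      (hU.mem_nhds (hρ hw))).hasFDerivAt.hasFDerivWithinAt)
    (fun w hw => ?_) (convex_closedBall x ρ) hy hz
  rw [← dist_eq_norm]
  exact (hK.dist_le_mul _ (hρ hw) _ (hρ (Metric.mem_closedBall_self hρ0))).trans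
    (mul_le_mul_of_nonneg_left hw K.2)

/-- The directional limsup bounds become uniform by compactness of the unit sphere in the hyperplane
orthogonal to `v`: as `Φ'` is Lipschitz, the difference quotients are equicontinuous in `ξ`. -/
theorem eventually_forall_inner_fderiv_sub_le [FiniteDimensional ℝ E] {Φ : E → E} {U : Set E}
    {x v : E} {K : ℝ≥0} {M : E →L[ℝ] E} {L₁ L : ℝ} (hU : IsOpen U) (hx : x ∈ U)
    (hK : LipschitzOnWith K (fderiv ℝ Φ) U) (hv : ‖v‖ = 1)
    (hL : ∀ ξ : E, inner ℝ ξ v = 0 →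
      limsup (fun t : ℝ => ((inner ℝ v (M (fderiv ℝ Φ (x + t • ξ) ξ - fderiv ℝ Φ x ξ)) / t : ℝ) :
        EReal)) (𝓝[>] 0) ≤ ((L₁ * ‖ξ‖ ^ 2 : ℝ) : EReal))
    (hLL : L₁ < L) :
    ∀ᶠ t in 𝓝 (0 : ℝ), ∀ ξ ∈ Metric.sphere (0 : E) 1 ∩ {ξ | inner ℝ ξ v = (0 : ℝ)}, 0 < t →
      inner ℝ v (M (fderiv ℝ Φ (x + t • ξ) ξ - fderiv ℝ Φ x ξ)) ≤ L * t := by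
  have hcomp : IsCompact (Metric.sphere (0 : E) 1 ∩ {ξ | inner ℝ ξ v = (0 : ℝ)}) :=
    (isCompact_sphere 0 1).inter_right (isClosed_eq (by fun_prop) continuous_const)
  -- Normalization is repeated as a premise because the local statement ranges over a full
  -- neighbourhood of `ξ₀`.
  suffices h : ∀ᶠ t in 𝓝 (0 : ℝ), ∀ ξ ∈ Metric.sphere (0 : E) 1 ∩ {ξ | inner ℝ ξ v = (0 : ℝ)},
      ξ ∈ Metric.sphere (0 : E) 1 → 0 < t →
        inner ℝ v (M (fderiv ℝ Φ (x + t • ξ) ξ - fderiv ℝ Φ x ξ)) ≤ L * t from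
    h.mono fun t h ξ hξ => h ξ hξ hξ.1
  refine hcomp.eventually_forall_of_forall_eventually fun ξ₀ hξ₀ => ?_
  have hξ₀1 : ‖ξ₀‖ = 1 := by simpa using hξ₀.1
  have h1 : ∀ᶠ t in 𝓝 (0 : ℝ), 0 < t →
      inner ℝ v (M (fderiv ℝ Φ (x + t • ξ₀) ξ₀ - fderiv ℝ Φ x ξ₀)) / t < (L₁ + L) / 2 := by
    have h := eventually_lt_of_limsup_lt ((hL ξ₀ hξ₀.2).trans_lt
      (EReal.coe_lt_coe_iff.2 (by rw [hξ₀1]; linarith : L₁ * ‖ξ₀‖ ^ 2 < (L₁ + L) / 2)))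
    rw [eventually_nhdsWithin_iff] at h
    filter_upwards [h] with t ht ht0 using EReal.coe_lt_coe_iff.1 (ht ht0)
  have hcont : Continuous fun q : ℝ × E => x + q.1 • q.2 := by fun_prop
  have h2 : ∀ᶠ q in 𝓝 ((0 : ℝ), ξ₀), x + q.1 • q.2 ∈ U :=
    hcont.continuousAt.eventually (hU.mem_nhds (by simpa using hx))
  have hcont' : Continuous fun q : ℝ × E => x + q.1 • ξ₀ := by fun_prop
  have h3 : ∀ᶠ q in 𝓝 ((0 : ℝ), ξ₀), x + q.1 • ξ₀ ∈ U :=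
    hcont'.continuousAt.eventually (hU.mem_nhds (by simpa using hx))
  have hcont'' : Continuous fun q : ℝ × E => ‖M‖ * (2 * K * ‖q.2 - ξ₀‖) := by fun_prop
  have h4 : ∀ᶠ q in 𝓝 ((0 : ℝ), ξ₀), ‖M‖ * (2 * K * ‖q.2 - ξ₀‖) < (L - L₁) / 2 :=
    hcont''.continuousAt.eventually (gt_mem_nhds (by simpa using hLL))
  have h5 : ∀ᶠ q in 𝓝 ((0 : ℝ), ξ₀), 0 < q.1 →
      inner ℝ v (M (fderiv ℝ Φ (x + q.1 • ξ₀) ξ₀ - fderiv ℝ Φ x ξ₀)) / q.1 < (L₁ + L) / 2 :=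
    (continuous_fst.tendsto ((0 : ℝ), ξ₀)).eventually h1
  filter_upwards [h2, h3, h4, h5] with ⟨t, ξ⟩ hq2 hq3 hq4 hq5 hξ ht
  simp only at *
  have hξ1 : ‖ξ‖ = 1 := by simpa using hξ
  have i1 := hq5 ht
  rw [div_lt_iff₀ ht] at i1
  set A := fderiv ℝ Φ with hA
  have i2 : ‖(A (x + t • ξ) ξ - A x ξ) - (A (x + t • ξ₀) ξ₀ - A x ξ₀)‖ ≤
      2 * K * ‖ξ - ξ₀‖ * t := by
    have e : (A (x + t • ξ) ξ - A x ξ) - (A (x + t • ξ₀) ξ₀ - A x ξ₀) =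
        (A (x + t • ξ) - A (x + t • ξ₀)) ξ + (A (x + t • ξ₀) - A x) (ξ - ξ₀) := by
      simp only [sub_apply, map_sub]
      abel
    have j1 : ‖A (x + t • ξ) - A (x + t • ξ₀)‖ ≤ K * (t * ‖ξ - ξ₀‖) := by
      have := hK.dist_le_mul _ hq2 _ hq3
      rwa [dist_eq_norm, dist_eq_norm, add_sub_add_left_eq_sub, ← smul_sub, norm_smul,
        Real.norm_eq_abs, abs_of_pos ht] at this
    have j2 : ‖A (x + t • ξ₀) - A x‖ ≤ K * t := by
      have := hK.dist_le_mul _ hq3 _ hx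
      rwa [dist_eq_norm, dist_eq_norm, add_sub_cancel_left, norm_smul,
        Real.norm_eq_abs, abs_of_pos ht, hξ₀1, mul_one] at this
    rw [e]
    calc _ ≤ ‖A (x + t • ξ) - A (x + t • ξ₀)‖ * ‖ξ‖ + ‖A (x + t • ξ₀) - A x‖ * ‖ξ - ξ₀‖ :=
          (norm_add_le _ _).trans (add_le_add (ContinuousLinearMap.le_opNorm _ _)
            (ContinuousLinearMap.le_opNorm _ _))
      _ ≤ K * (t * ‖ξ - ξ₀‖) * 1 + K * t * ‖ξ - ξ₀‖ := by rw [hξ1]; gcongr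
      _ = _ := by ring
  have i3 : inner ℝ v (M ((A (x + t • ξ) ξ - A x ξ) - (A (x + t • ξ₀) ξ₀ - A x ξ₀))) ≤
      ‖M‖ * (2 * K * ‖ξ - ξ₀‖ * t) := by
    refine (real_inner_le_norm _ _).trans ?_
    rw [hv, one_mul]
    exact (M.le_opNorm _).trans (mul_le_mul_of_nonneg_left i2 (norm_nonneg _))
  rw [map_sub M (A (x + t • ξ) ξ - A x ξ), inner_sub_right] at i3
  have i4 := mul_lt_mul_of_pos_right hq4 ht
  linarith

/-- Integration of the uniform derivative bound along rays; the first-order term vanishes since `M`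
inverts `Φ'(x)` and `η ⊥ v`. -/
theorem eventually_inner_image_sub_le [FiniteDimensional ℝ E] {Φ : E → E} {U : Set E}
    {x v : E} {K : ℝ≥0} {M : E →L[ℝ] E} {L₁ L : ℝ} (hU : IsOpen U) (hx : x ∈ U)
    (hΦ : DifferentiableOn ℝ Φ U)
    (hK : LipschitzOnWith K (fderiv ℝ Φ) U) (hv : ‖v‖ = 1) (hM : ∀ ξ, M (fderiv ℝ Φ x ξ) = ξ)
    (hL : ∀ ξ : E, inner ℝ ξ v = 0 →
      limsup (fun t : ℝ => ((inner ℝ v (M (fderiv ℝ Φ (x + t • ξ) ξ - fderiv ℝ Φ x ξ)) / t : ℝ) :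
        EReal)) (𝓝[>] 0) ≤ ((L₁ * ‖ξ‖ ^ 2 : ℝ) : EReal))
    (hLL : L₁ < L) :
    ∀ᶠ η in 𝓝 (0 : E), inner ℝ η v = (0 : ℝ) →
      inner ℝ v (M (Φ (x + η) - Φ x)) ≤ L / 2 * ‖η‖ ^ 2 := by
  obtain ⟨τ, hτ, h1⟩ := Metric.eventually_nhds_iff.1
    (eventually_forall_inner_fderiv_sub_le hU hx hK hv hL hLL)
  obtain ⟨δ, hδ, h2⟩ := Metric.isOpen_iff.1 hU x hx
  filter_upwards [Metric.ball_mem_nhds 0 hτ, Metric.ball_mem_nhds 0 hδ] with η hητ hηδ hηv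
  rw [mem_ball_zero_iff] at hητ hηδ
  rcases eq_or_ne η 0 with rfl | hη
  · simp
  have h0 : 0 < ‖η‖ := norm_pos_iff.2 hη
  set ξ := ‖η‖⁻¹ • η with hξ
  have hξ1 : ‖ξ‖ = 1 := by rw [hξ, norm_smul, norm_inv, norm_norm, inv_mul_cancel₀ h0.ne']
  have hξv : inner ℝ ξ v = (0 : ℝ) := by rw [hξ, real_inner_smul_left, hηv, mul_zero]
  have hξη : ‖η‖ • ξ = η := smul_inv_smul₀ h0.ne' η
  have hmem : ∀ t ∈ Set.Icc 0 ‖η‖, x + t • ξ ∈ U := by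
    intro t ht
    apply h2
    rw [mem_ball_iff_norm, add_sub_cancel_left, norm_smul, hξ1, Real.norm_eq_abs,
      abs_of_nonneg ht.1, mul_one]
    exact ht.2.trans_lt hηδ
  have hderiv : ∀ t ∈ Set.Icc 0 ‖η‖,
      HasDerivAt (fun t : ℝ => inner ℝ v (M (Φ (x + t • ξ) - Φ x)) - L / 2 * t ^ 2)
        (inner ℝ v (M (fderiv ℝ Φ (x + t • ξ) ξ)) - L * t) t := by
    intro t ht
    have d1 : HasDerivAt (fun t : ℝ => x + t • ξ) ξ t := by
      simpa using ((hasDerivAt_id t).smul_const ξ).const_add x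
    have d2 := ((hΦ _ (hmem t ht)).differentiableAt
      (hU.mem_nhds (hmem t ht))).hasFDerivAt.comp_hasDerivAt t d1
    have d3 := ((innerSL ℝ v).comp M).hasFDerivAt.comp_hasDerivAt t (d2.sub_const (Φ x))
    have d4 := d3.sub ((hasDerivAt_pow 2 t).const_mul (L / 2))
    refine HasDerivAt.congr_deriv
      (f := fun t : ℝ => inner ℝ v (M (Φ (x + t • ξ) - Φ x)) - L / 2 * t ^ 2) d4 ?_
    rw [ContinuousLinearMap.comp_apply, innerSL_apply_apply]
    norm_num
    ring
  have hanti := antitoneOn_of_deriv_nonpos (convex_Icc 0 ‖η‖)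
    (fun t ht => (hderiv t ht).continuousAt.continuousWithinAt)
    (fun t ht => (hderiv t (interior_subset ht)).differentiableAt.differentiableWithinAt)
    (fun t ht => by
      rw [(hderiv t (interior_subset ht)).deriv]
      rw [interior_Icc] at ht
      have := h1 (y := t) (by simpa [abs_of_pos ht.1] using ht.2.trans hητ) ξ
        ⟨by simpa using hξ1, hξv⟩ ht.1
      rw [map_sub, inner_sub_right, hM, real_inner_comm ξ v, hξv] at this
      linarith)
  have := hanti (Set.left_mem_Icc.2 h0.le) (Set.right_mem_Icc.2 h0.le) h0.le
  simp only [hξη, zero_smul, add_zero, sub_self, map_zero, inner_zero_right] at this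
  linarith

theorem eventually_image_supported [FiniteDimensional ℝ E] {Φ : E → E} {U Ω : Set E}
    {x v : E} {K : ℝ≥0} {M : E →L[ℝ] E} {s R L₁ L₂ : ℝ} (hU : IsOpen U) (hx : x ∈ U)
    (hΦ : DifferentiableOn ℝ Φ U)
    (hK : LipschitzOnWith K (fderiv ℝ Φ) U) (hv : ‖v‖ = 1) (hM : ∀ ξ, M (fderiv ℝ Φ x ξ) = ξ)
    (hL₁ : ∀ ξ : E, inner ℝ ξ v = 0 →
      limsup (fun t : ℝ => ((inner ℝ v (M (fderiv ℝ Φ (x + t • ξ) ξ - fderiv ℝ Φ x ξ)) / t : ℝ) :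
        EReal)) (𝓝[>] 0) ≤ ((L₁ * ‖ξ‖ ^ 2 : ℝ) : EReal))
    (hL₂ : ∀ ξ : E, inner ℝ ξ v = 0 → ‖fderiv ℝ Φ x ξ‖ ^ 2 * ‖M‖ ≤ L₂ * ‖ξ‖ ^ 2)
    (hs : 0 < s) (hΩ : ∀ y ∈ Ω, ‖y - x‖ ^ 2 + 2 * s * inner ℝ (y - x) v ≤ 0)
    (hR : 0 < R) (hsR : s * L₂ < R * (1 - s * L₁)) :
    ∀ᶠ y in 𝓝[Ω] x, ‖M‖ * ‖Φ y - Φ x‖ ^ 2 + 2 * R * inner ℝ v (M (Φ y - Φ x)) ≤ 0 := by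
  obtain ⟨L, hL, hLR⟩ : ∃ L, L₁ < L ∧ s * L₂ + s * R * L < R := by
    -- This `L` spends half of the gap `R * (1 - s * L₁) - s * L₂`; the other half absorbs the error
    -- terms.
    refine ⟨L₁ + (R * (1 - s * L₁) - s * L₂) / (2 * (s * R)), ?_, ?_⟩
    · have : 0 < (R * (1 - s * L₁) - s * L₂) / (2 * (s * R)) :=
        div_pos (by linarith) (by positivity)
      linarith
    · have : s * R * ((R * (1 - s * L₁) - s * L₂) / (2 * (s * R))) =
        (R * (1 - s * L₁) - s * L₂) / 2 := by field_simp
      rw [mul_add, this]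
      linarith
  obtain ⟨δ, hδ, hball⟩ := Metric.isOpen_iff.1 hU x hx
  obtain ⟨τ, hτ, hsecond⟩ := Metric.eventually_nhds_iff.1
    (eventually_inner_image_sub_le hU hx hΦ hK hv hM hL₁ hL)
  set D := fderiv ℝ Φ x with hD
  set C := 2 * s * K + ‖D‖ with hC
  have hC0 : 0 ≤ C := by positivity
  -- `Q` collects the coefficients of all errors, each of order `a * ρ` thanks to `ρ ^ 2 ≤ 2 * s *
  -- a`.
  set Q := 2 * R * (‖M‖ * K) + ‖M‖ * (2 * C * ‖D‖ + C ^ 2) with hQ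
  have hlim : ∀ᶠ y in 𝓝 x, Q * ‖y - x‖ < 2 * min R (R - (s * L₂ + s * R * L)) := by
    have hc : Continuous fun y => Q * ‖y - x‖ := by fun_prop
    refine hc.continuousAt.eventually (gt_mem_nhds ?_)
    simpa using ⟨hR, hLR⟩
  rw [eventually_nhdsWithin_iff]
  filter_upwards [hlim, Metric.ball_mem_nhds x hδ, Metric.ball_mem_nhds x hτ] with y hy1 hy2 hy3 hyΩ
  rw [mem_ball_iff_norm] at hy2 hy3
  have hyΩ' := hΩ y hyΩ
  set ρ := ‖y - x‖ with hρ
  have hρ0 : 0 ≤ ρ := norm_nonneg _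
  have hρU : Metric.closedBall x ρ ⊆ U := (Metric.closedBall_subset_ball hy2).trans hball
  set a : ℝ := -inner ℝ (y - x) v with ha
  have haρ : ρ ^ 2 ≤ 2 * s * a := by rw [ha]; linarith
  have ha0 : 0 ≤ a := by
    have : 0 ≤ 2 * s * a := (sq_nonneg ρ).trans haρ
    exact nonneg_of_mul_nonneg_right this (by positivity)
  have haρ' : a ≤ ρ := by
    have := (abs_le.1 (abs_real_inner_le_norm (y - x) v)).1
    rw [hv, mul_one] at this
    linarith
  set η := y - x + a • v with hη
  have hηv : inner ℝ η v = (0 : ℝ) := by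
    rw [hη, inner_add_left, real_inner_smul_left, real_inner_self_eq_norm_sq, hv, ha]
    ring
  have hηnorm : ‖η‖ ^ 2 = ρ ^ 2 - a ^ 2 := by
    rw [hη, norm_add_sq_real, real_inner_smul_right, norm_smul, hv, Real.norm_eq_abs, mul_one,
      sq_abs, show inner ℝ (y - x) v = -a by rw [ha, neg_neg]]
    ring
  have hηρ : ‖η‖ ≤ ρ := by
    rw [← sq_le_sq₀ (norm_nonneg _) hρ0, hηnorm]
    linarith [sq_nonneg a]
  have hyη : y - (x + η) = -(a • v) := by rw [hη]; abel
  have hmemy : y ∈ Metric.closedBall x ρ := by rw [mem_closedBall_iff_norm]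
  have hmemη : x + η ∈ Metric.closedBall x ρ := by
    rw [mem_closedBall_iff_norm, add_sub_cancel_left]
    exact hηρ
  have hsec : inner ℝ v (M (Φ (x + η) - Φ x)) ≤ L / 2 * ‖η‖ ^ 2 :=
    hsecond (by rw [dist_zero_right]; exact hηρ.trans_lt hy3) hηv
  have hnormal : inner ℝ v (M (Φ y - Φ (x + η))) ≤ ‖M‖ * K * ρ * a - a := by
    have h1 := norm_image_sub_sub_fderiv_le hU hΦ hK hρU hmemη hmemy
    rw [hyη, norm_neg, norm_smul, hv, mul_one, Real.norm_eq_abs, abs_of_nonneg ha0] at h1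
    have h2 : inner ℝ v (M (Φ y - Φ (x + η) - D (-(a • v)))) ≤ ‖M‖ * (K * ρ * a) := by
      refine (real_inner_le_norm _ _).trans ?_
      rw [hv, one_mul]
      exact (M.le_opNorm _).trans (mul_le_mul_of_nonneg_left h1 (norm_nonneg _))
    rw [map_sub, hM, inner_sub_right, inner_neg_right, real_inner_smul_right,
      real_inner_self_eq_norm_sq, hv] at h2
    linarith
  have hinner : inner ℝ v (M (Φ y - Φ x)) ≤ L / 2 * ‖η‖ ^ 2 - a + ‖M‖ * K * ρ * a := by
    rw [← sub_add_sub_cancel (Φ y) (Φ (x + η)) (Φ x), map_add, inner_add_right]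
    linarith
  have hdist : ‖Φ y - Φ x‖ ≤ ‖D η‖ + C * a := by
    have h1 := norm_image_sub_sub_fderiv_le hU hΦ hK hρU (Metric.mem_closedBall_self hρ0) hmemy
    have h2 : Φ y - Φ x = D η + ((Φ y - Φ x - D (y - x)) - a • D v) := by
      rw [hη, map_add, map_smul]
      abel
    have h3 : ‖a • D v‖ ≤ a * ‖D‖ := by
      rw [norm_smul, Real.norm_eq_abs, abs_of_nonneg ha0]
      have := D.le_opNorm v
      rw [hv, mul_one] at this
      exact mul_le_mul_of_nonneg_left this ha0
    have h4 : (K : ℝ) * ρ * ‖y - x‖ ≤ K * (2 * s * a) := by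
      rw [← hρ, mul_assoc, ← sq]
      exact mul_le_mul_of_nonneg_left haρ K.2
    rw [h2]
    refine (norm_add_le _ _).trans (add_le_add le_rfl ((norm_sub_le _ _).trans ?_))
    rw [hC]
    linarith
  have hDη : ‖D η‖ ≤ ‖D‖ * ρ := (D.le_opNorm _).trans (mul_le_mul_of_nonneg_left hηρ (norm_nonneg _))
  have hdist2 : ‖Φ y - Φ x‖ ^ 2 ≤ ‖D η‖ ^ 2 + (2 * C * ‖D‖ + C ^ 2) * (a * ρ) := by
    have h1 := pow_le_pow_left₀ (norm_nonneg _) hdist 2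
    have h2 : C * a * ‖D η‖ ≤ C * a * (‖D‖ * ρ) := mul_le_mul_of_nonneg_left hDη (by positivity)
    have h3 : C ^ 2 * a * a ≤ C ^ 2 * a * ρ := mul_le_mul_of_nonneg_left haρ' (by positivity)
    nlinarith
  have hfirst : ‖M‖ * ‖Φ y - Φ x‖ ^ 2 ≤
      L₂ * ‖η‖ ^ 2 + ‖M‖ * (2 * C * ‖D‖ + C ^ 2) * (a * ρ) := by
    have h1 := mul_le_mul_of_nonneg_left hdist2 (norm_nonneg M)
    have h2 := hL₂ η hηv
    linarith
  have htotal : ‖M‖ * ‖Φ y - Φ x‖ ^ 2 + 2 * R * inner ℝ v (M (Φ y - Φ x)) ≤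
      (L₂ + R * L) * ‖η‖ ^ 2 + a * (Q * ρ - 2 * R) := by
    have h1 := mul_le_mul_of_nonneg_left hinner (by positivity : 0 ≤ 2 * R)
    rw [hQ]
    linarith
  refine htotal.trans ?_
  have hηa : ‖η‖ ^ 2 ≤ 2 * s * a := by
    rw [hηnorm]
    linarith [sq_nonneg a]
  have hm1 := min_le_left R (R - (s * L₂ + s * R * L))
  have hm2 := min_le_right R (R - (s * L₂ + s * R * L))
  -- The bound on `‖η‖ ^ 2` helps only when its coefficient is nonnegative; otherwise that term is
  -- dropped.
  rcases le_total (L₂ + R * L) 0 with hneg | hpos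
  · have h1 := mul_nonpos_of_nonpos_of_nonneg hneg (sq_nonneg ‖η‖)
    have h2 := mul_nonpos_of_nonneg_of_nonpos ha0 (by linarith : Q * ρ - 2 * R ≤ 0)
    linarith
  · have h1 := mul_le_mul_of_nonneg_left hηa hpos
    have h2 := mul_nonpos_of_nonneg_of_nonpos ha0
      (by linarith : Q * ρ - 2 * R + 2 * (s * L₂ + s * R * L) ≤ 0)
    linarith

end SecondOrder

/-! ### Transport of support through the diffeomorphism -/

section Diffeo

variable {n : ℕ} {Φ : EuclideanSpace ℝ (Fin n) → EuclideanSpace ℝ (Fin n)}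
  {U V : Set (EuclideanSpace ℝ (Fin n))}

theorem IsC11Diffeo.fderiv_inverse (hΦ : IsC11Diffeo Φ U V) {x : EuclideanSpace ℝ (Fin n)}
    (hx : x ∈ U) :
    ∀ ξ, (fderiv ℝ Φ x).inverse (fderiv ℝ Φ x ξ) = ξ := by
  obtain ⟨hU, hV, hbij, ⟨hΦ1, -⟩, Ψ, hinv, hΨ1, -⟩ := hΦ
  have hy : Φ x ∈ V := hbij.mapsTo hx
  have d1 : HasFDerivAt Φ (fderiv ℝ Φ x) x :=
    ((hΦ1.differentiableOn one_ne_zero x hx).differentiableAt (hU.mem_nhds hx)).hasFDerivAt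
  have d2 : HasFDerivAt Ψ (fderiv ℝ Ψ (Φ x)) (Φ x) :=
    ((hΨ1.differentiableOn one_ne_zero _ hy).differentiableAt (hV.mem_nhds hy)).hasFDerivAt
  have e1 : (fderiv ℝ Ψ (Φ x)).comp (fderiv ℝ Φ x) = ContinuousLinearMap.id ℝ _ := by
    refine (d2.comp x d1).unique ((hasFDerivAt_id x).congr_of_eventuallyEq ?_)
    filter_upwards [hU.mem_nhds hx] with z hz using hinv.1 hz
  have e2 : (fderiv ℝ Φ x).comp (fderiv ℝ Ψ (Φ x)) = ContinuousLinearMap.id ℝ _ := by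
    have d1' : HasFDerivAt Φ (fderiv ℝ Φ x) (Ψ (Φ x)) := by rwa [hinv.1 hx]
    refine (d1'.comp (Φ x) d2).unique ((hasFDerivAt_id (Φ x)).congr_of_eventuallyEq ?_)
    filter_upwards [hV.mem_nhds hy] with z hz using hinv.2 hz
  rw [ContinuousLinearMap.inverse_eq e2 e1]
  exact DFunLike.congr_fun e1

theorem IsC11Diffeo.isOpen_image (hΦ : IsC11Diffeo Φ U V) {W : Set (EuclideanSpace ℝ (Fin n))}
    (hW : IsOpen W) (hWU : W ⊆ U) : IsOpen (Φ '' W) := by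
  obtain ⟨hU, hV, hbij, -, Ψ, hinv, hΨ1, -⟩ := hΦ
  have : Φ '' W = V ∩ Ψ ⁻¹' W := by
    ext z
    constructor
    · rintro ⟨y, hy, rfl⟩
      exact ⟨hbij.mapsTo (hWU hy), by rwa [Set.mem_preimage, hinv.1 (hWU hy)]⟩
    · rintro ⟨hz, hz'⟩
      exact ⟨Ψ z, hz', hinv.2 hz⟩
  rw [this]
  exact hΨ1.continuousOn.isOpen_inter_preimage hV hW

theorem IsC11Diffeo.tendsto_image (hΦ : IsC11Diffeo Φ U V) {Ω : Set (EuclideanSpace ℝ (Fin n))}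
    (hΩ : Ω ⊆ U) {x : EuclideanSpace ℝ (Fin n)} (hx : x ∈ U)
    {P : EuclideanSpace ℝ (Fin n) → Prop} (h : ∀ᶠ y in 𝓝[Ω] x, P (Φ y)) :
    ∀ᶠ z in 𝓝[Φ '' Ω] (Φ x), P z := by
  obtain ⟨hU, hV, hbij, -, Ψ, hinv, hΨ1, -⟩ := hΦ
  rw [eventually_nhdsWithin_iff] at h ⊢
  have hc : Tendsto Ψ (𝓝 (Φ x)) (𝓝 x) := by
    have := hΨ1.continuousOn.continuousAt (hV.mem_nhds (hbij.mapsTo hx))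
    rwa [ContinuousAt, hinv.1 hx] at this
  filter_upwards [hc.eventually h] with z hz
  rintro ⟨y, hy, rfl⟩
  rw [hinv.1 (hΩ hy)] at hz
  exact hz hy

theorem IsC11Diffeo.locallySupported_image (hΦ : IsC11Diffeo Φ U V)
    {s : ℝ} (hs : 0 < s) {Ω : Set (EuclideanSpace ℝ (Fin n))} (hΩU : Ω ⊆ U)
    (hΩs : IsRConvex s Ω) (hΩc : IsClosed Ω) (hΩ : Ω ≠ Set.univ) {L₁ L₂ : ℝ}
    (hL : ∀ x ∈ frontier Ω, ∃ v : EuclideanSpace ℝ (Fin n), IsUnitNormal Ω x v ∧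
      ∀ ξ : EuclideanSpace ℝ (Fin n), inner ℝ ξ v = 0 →
        limsup (fun t : ℝ => ((inner ℝ v ((fderiv ℝ Φ x).inverse
            (fderiv ℝ Φ (x + t • ξ) ξ - fderiv ℝ Φ x ξ)) / t : ℝ) : EReal)) (𝓝[>] 0)
          ≤ ((L₁ * ‖ξ‖ ^ 2 : ℝ) : EReal) ∧
        ‖fderiv ℝ Φ x ξ‖ ^ 2 * ‖(fderiv ℝ Φ x).inverse‖ ≤ L₂ * ‖ξ‖ ^ 2)
    (hsL : s * L₁ < 1) (hr : 0 < s * L₂ / (1 - s * L₁)) :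
    LocallySupported (s * L₂ / (1 - s * L₁)) (Φ '' interior Ω) (Φ '' Ω) := by
  rintro _ ⟨⟨x, hx, rfl⟩, hxO⟩
  have hxf : x ∈ frontier Ω := by
    rw [hΩc.frontier_eq]
    exact ⟨hx, fun h => hxO ⟨x, h, rfl⟩⟩
  obtain ⟨v, hv, hvL⟩ := hL x hxf
  have hM := hΦ.fderiv_inverse (hΩU hx)
  set M := (fderiv ℝ Φ x).inverse with hMdef
  -- Normals transform by the adjoint of the inverse derivative. Normalizing costs the factor `‖m‖ ≤
  -- ‖M‖`, which explains the operator norm in the hypothesis on `L₂`.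
  set m := ContinuousLinearMap.adjoint M v with hm
  have hinner : ∀ z, inner ℝ z m = (inner ℝ v (M z) : ℝ) := fun z => by
    rw [hm, ContinuousLinearMap.adjoint_inner_right, real_inner_comm]
  have hm0 : 0 < ‖m‖ := by
    refine norm_pos_iff.2 fun h0 => ?_
    have := hinner (fderiv ℝ Φ x v)
    rw [h0, inner_zero_right, hM, real_inner_self_eq_norm_sq, hv.2.1] at this
    norm_num at this
  have hmM : ‖m‖ ≤ ‖M‖ := by
    have := (ContinuousLinearMap.adjoint M).le_opNorm v
    rwa [hv.2.1, mul_one, LinearIsometryEquiv.norm_map] at this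
  refine ⟨‖m‖⁻¹ • m, by rw [norm_smul, norm_inv, norm_norm, inv_mul_cancel₀ hm0.ne'],
    fun R hR => ?_⟩
  have hR0 : 0 < R := hr.trans hR
  obtain ⟨K, hK⟩ := hΦ.2.2.2.1.2
  refine hΦ.tendsto_image hΩU (hΩU hx)
    (P := fun z => ‖z - Φ x‖ ^ 2 + 2 * R * inner ℝ (z - Φ x) (‖m‖⁻¹ • m) ≤ 0) ?_
  filter_upwards [eventually_image_supported (R := R) hΦ.1 (hΩU hx)
    (hΦ.2.2.2.1.1.differentiableOn one_ne_zero) hK hv.2.1 hM (fun ξ hξ => (hvL ξ hξ).1)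
    (fun ξ hξ => (hvL ξ hξ).2) hs (fun y hy => hΩs.norm_sq_add_inner_nonpos hs hΩ hx hv hy) hR0
    ((div_lt_iff₀ (by linarith)).1 hR)] with y hy
  rw [real_inner_smul_right, hinner]
  have h1 : ‖m‖ * ‖Φ y - Φ x‖ ^ 2 ≤ ‖M‖ * ‖Φ y - Φ x‖ ^ 2 :=
    mul_le_mul_of_nonneg_right hmM (by positivity)
  have h2 : ‖m‖ * (‖Φ y - Φ x‖ ^ 2 + 2 * R * (‖m‖⁻¹ * inner ℝ v (M (Φ y - Φ x)))) ≤ 0 := by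
    rw [mul_add, show ‖m‖ * (2 * R * (‖m‖⁻¹ * inner ℝ v (M (Φ y - Φ x)))) =
      2 * R * inner ℝ v (M (Φ y - Φ x)) by field_simp]
    linarith
  exact nonpos_of_mul_nonpos_right h2 hm0

end Diffeo

theorem mainTheorem7 (n : ℕ) (hn : 2 ≤ n)
    (U V : Set (EuclideanSpace ℝ (Fin n)))
    (Φ : EuclideanSpace ℝ (Fin n) → EuclideanSpace ℝ (Fin n)) (hΦ : IsC11Diffeo Φ U V)
    (s : ℝ) (hs : 0 < s)
    (Ω : Set (EuclideanSpace ℝ (Fin n))) (hΩU : Ω ⊆ U) (hΩs : IsRConvex s Ω)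
    (hΩc : IsClosed Ω) (hΩ : Ω ≠ Set.univ)
    (L₁ L₂ : ℝ)
    (hL : ∀ x ∈ frontier Ω, ∃ v : EuclideanSpace ℝ (Fin n), IsUnitNormal Ω x v ∧
      ∀ ξ : EuclideanSpace ℝ (Fin n), inner ℝ ξ v = 0 →
        limsup (fun t : ℝ => ((inner ℝ v ((fderiv ℝ Φ x).inverse
            (fderiv ℝ Φ (x + t • ξ) ξ - fderiv ℝ Φ x ξ)) / t : ℝ) : EReal)) (𝓝[>] 0)
          ≤ ((L₁ * ‖ξ‖ ^ 2 : ℝ) : EReal) ∧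
        ‖fderiv ℝ Φ x ξ‖ ^ 2 * ‖(fderiv ℝ Φ x).inverse‖ ≤ L₂ * ‖ξ‖ ^ 2)
    (hsL : s * L₁ < 1) :
    (Ω.Nonempty → 0 < s * L₂ / (1 - s * L₁)) ∧
      IsRConvex (s * L₂ / (1 - s * L₁)) (Φ '' Ω) := by
  have hpos : Ω.Nonempty → 0 < s * L₂ / (1 - s * L₁) := by
    intro hne
    obtain ⟨x, hx⟩ := nonempty_frontier_iff.2 ⟨hne, hΩ⟩
    obtain ⟨v, -, hvL⟩ := hL x hx
    -- A nonzero tangent direction exists because `2 ≤ n`; it forces `L₂ > 0`.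
    obtain ⟨ξ, hξ, hξv⟩ := exists_unit_orthogonal hn v
    have hxU := hΩU (hΩc.frontier_subset hx)
    have hM := hΦ.fderiv_inverse hxU
    have h1 := (hvL ξ hξv).2
    have h2 : 0 < ‖fderiv ℝ Φ x ξ‖ := by
      refine norm_pos_iff.2 fun h0 => ?_
      have := hM ξ
      rw [h0, map_zero] at this
      rw [← this, norm_zero] at hξ
      exact zero_ne_one hξ
    have h3 : 0 < ‖(fderiv ℝ Φ x).inverse‖ := by
      refine norm_pos_iff.2 fun h0 => ?_
      have := hM ξ
      rw [h0, zero_apply] at this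
      rw [← this, norm_zero] at hξ
      exact zero_ne_one hξ
    rw [hξ, one_pow, mul_one] at h1
    have : 0 < L₂ := (by positivity : 0 < ‖fderiv ℝ Φ x ξ‖ ^ 2 * _).trans_le h1
    exact div_pos (by positivity) (by linarith)
  refine ⟨hpos, ?_⟩
  rcases Ω.eq_empty_or_nonempty with rfl | hne
  · rintro x ⟨y, hy, -⟩
    exact hy.elim
  have hr := hpos hne
  -- A single point has empty interior, so the sweeping argument does not apply to it.
  rcases hne.exists_eq_singleton_or_nontrivial with ⟨p, rfl⟩ | hnt
  · rw [Set.image_singleton]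
    exact isRConvex_singleton hr _
  have hint := hΩs.nonempty_interior hs hnt
  have hcont : ContinuousOn Φ Ω := hΦ.2.2.2.1.1.continuousOn.mono hΩU
  have hcomp : IsCompact Ω := Metric.isCompact_of_isClosed_isBounded hΩc (hΩs.isBounded hΩ)
  have hA : IsCompact (Φ '' Ω) := hcomp.image_of_continuousOn hcont
  have hO : IsOpen (Φ '' interior Ω) :=
    hΦ.isOpen_image isOpen_interior (interior_subset.trans hΩU)
  have hOA : Φ '' interior Ω ⊆ Φ '' Ω := Set.image_mono interior_subset
  have hcl : closure (interior Ω) = Ω := by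
    rw [hΩs.convex.closure_interior_eq_closure_of_nonempty_interior hint, hΩc.closure_eq]
  have hAO : Φ '' Ω ⊆ closure (Φ '' interior Ω) := by
    have := ContinuousOn.image_closure (f := Φ) (s := interior Ω) (by rwa [hcl])
    rwa [hcl] at this
  have hconn : IsPathConnected (Φ '' interior Ω) :=
    (hΩs.convex.interior.isPathConnected hint).image' (hcont.mono interior_subset)
  refine isRConvex_of_supported hr hO hA.isClosed hOA (hint.image Φ) fun p hp => ?_
  exact (hΦ.locallySupported_image hs hΩU hΩs hΩc hΩ hL hsL hr).norm_sq_add_inner_nonpos hr hO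
    hA.isClosed hOA hAO hconn (hA.isBounded.subset hOA) (exists_unit_orthogonal hn) hp
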